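/- For $d\ge 0$ let $F_d=S^d(\mathbb C^2)$ be the irreducible representation of $\mathfrak{sl}_2=\mathfrak{sl}_2(\mathbb C)$ of dimension $d+1$. For $m,d\ge 0$ let $a_j=\dim\operatorname{Hom}_{\mathfrak{sl}_2}\bigl(F_j,\,S^m[S^d(\mathbb C^2)]\bigr)$ be the multiplicity of $F_j$ ($j\ge 0$) in the $m$-th symmetric power of $S^d(\mathbb C^2)$, and put $$\ell(m,d)=\min\{\,j\ge 0 : a_j>0\,\}.$$ Let $$E=\{(5,6),(5,10),(5,14),(6,7),(6,9),(6,11),(6,13),(7,10)\}.$$ **Proposition.** The minimum defining $\ell(m,d)$ exists for all $m,d\ge 0$, $\ell(m,d)=\ell(d,m)$, and the values of $\ell$ are as follows. - For all $m\ge 0$, $\ell(m,0)=0$ and $\ell(m,1)=m$. - For all $m\ge 0$, $\ell(m,2)=0$ if $m$ is even, and $\ell(m,2)=2$ if $m$ is odd. - For all $m\ge 0$, $\ell(m,3)=0$ if $m\equiv 0 \pmod 4$, $\ell(m,3)=2$ if $m\equiv 2\pmod 4$, and $\ell(m,3)=3$ if $m\equiv\pm1\pmod 4$. - For all $m\ge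 0$ with $m\ne 1$, $\ell(4,m)=0$; and $\ell(4,1)=4$. - For all $d\ge m\ge 5$, $$\ell(m,d)=\begin{cases}2,&(m,d)\in E,\\ 1,&(m,d)\notin E\text{ and } m,d \text{ both odd},\\ 0,&\text{otherwise.}\end{cases}$$ -/

import Mathlib

noncomputable section

namespace BinaryForms

open Module

attribute [local instance 100] LieRing.ofAssociativeRing

section SymmetricPowers

variable {L : Type*} [LieRing L] [LieAlgebra ℂ L]
variable {V : Type*} [AddCommGroup V] [Module ℂ V]

/-- The algebra map `S(V) → S(V)[ε]`, `v ↦ v + ε T v`. -/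
def symDualLift (T : Module.End ℂ V) :
    SymmetricAlgebra ℂ V →ₐ[ℂ] DualNumber (SymmetricAlgebra ℂ V) :=
  SymmetricAlgebra.lift
    ((TrivSqZeroExt.inlAlgHom ℂ (SymmetricAlgebra ℂ V) (SymmetricAlgebra ℂ V)).toLinearMap ∘ₗ
        SymmetricAlgebra.ι ℂ V +
      (TrivSqZeroExt.inrHom (SymmetricAlgebra ℂ V) (SymmetricAlgebra ℂ V)).restrictScalars ℂ ∘ₗ
        SymmetricAlgebra.ι ℂ V ∘ₗ T)

theorem fst_symDualLift (T : Module.End ℂ V) (a : SymmetricAlgebra ℂ V) :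
    (symDualLift T a).fst = a := by
  have h : (TrivSqZeroExt.fstHom ℂ (SymmetricAlgebra ℂ V) (SymmetricAlgebra ℂ V)).comp
      (symDualLift T) = AlgHom.id ℂ _ := by
    apply SymmetricAlgebra.algHom_ext
    ext v
    simp [symDualLift]
  exact DFunLike.congr_fun h a

/-- The unique derivation of the symmetric algebra `S(V)` that extends the endomorphism `T` of
`V`. -/
def symDerivation (T : Module.End ℂ V) :
    Derivation ℂ (SymmetricAlgebra ℂ V) (SymmetricAlgebra ℂ V) :=
  Derivation.mk'
    ((TrivSqZeroExt.sndHom (SymmetricAlgebra ℂ V) (SymmetricAlgebra ℂ V)).restrictScalars ℂ ∘ₗ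
      (symDualLift T).toLinearMap)
    (fun a b => by
      simp [fst_symDualLift, mul_comm b])

@[simp]
theorem symDerivation_ι (T : Module.End ℂ V) (v : V) :
    symDerivation T (SymmetricAlgebra.ι ℂ V v) = SymmetricAlgebra.ι ℂ V (T v) := by
  simp [symDerivation, symDualLift]

theorem symDerivation_ext {D₁ D₂ : Derivation ℂ (SymmetricAlgebra ℂ V) (SymmetricAlgebra ℂ V)}
    (h : ∀ v, D₁ (SymmetricAlgebra.ι ℂ V v) = D₂ (SymmetricAlgebra.ι ℂ V v)) : D₁ = D₂ := by
  ext a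
  induction a using SymmetricAlgebra.induction with
  | algebraMap r => simp
  | ι v => exact h v
  | mul a b ha hb => simp [ha, hb]
  | add a b ha hb => simp [ha, hb]

variable (V) in
/-- Extending endomorphisms to derivations is a morphism of Lie algebras
`𝔤𝔩(V) → Der S(V)`. -/
def symDerivationHom :
    Module.End ℂ V →ₗ⁅ℂ⁆ Derivation ℂ (SymmetricAlgebra ℂ V) (SymmetricAlgebra ℂ V) where
  toFun := symDerivation
  map_add' S T := symDerivation_ext fun v => by simp
  map_smul' c T := symDerivation_ext fun v => by simp
  map_lie' {S T} := symDerivation_ext fun v => by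
    simp [Derivation.commutator_apply, Ring.lie_def]

variable [LieRingModule L V] [LieModule ℂ L V]

/-- A Lie algebra `L` acting on `V` acts on the symmetric algebra `S(V)` by derivations. -/
instance symLieRingModule : LieRingModule L (SymmetricAlgebra ℂ V) :=
  LieRingModule.compLieHom (SymmetricAlgebra ℂ V)
    ((symDerivationHom V).comp (LieModule.toEnd ℂ L V))

instance symLieModule : LieModule ℂ L (SymmetricAlgebra ℂ V) :=
  LieModule.compLieHom (SymmetricAlgebra ℂ V)
    ((symDerivationHom V).comp (LieModule.toEnd ℂ L V))

theorem lie_sym_eq (x : L) (a : SymmetricAlgebra ℂ V) :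
    ⁅x, a⁆ = symDerivation (LieModule.toEnd ℂ L V x) a := rfl

@[simp]
theorem lie_sym_ι (x : L) (v : V) :
    ⁅x, SymmetricAlgebra.ι ℂ V v⁆ = SymmetricAlgebra.ι ℂ V ⁅x, v⁆ := by
  simp [lie_sym_eq]

theorem lie_sym_mul (x : L) (a b : SymmetricAlgebra ℂ V) :
    ⁅x, a * b⁆ = a * ⁅x, b⁆ + ⁅x, a⁆ * b := by
  simp [lie_sym_eq, mul_comm]

variable (L V) in
/-- The symmetric power `S^m(V)`, the span in `S(V)` of the products of `m` elements of `V`, as a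
representation of `L`. -/
def symPow (m : ℕ) : LieSubmodule ℂ L (SymmetricAlgebra ℂ V) where
  __ := LinearMap.range (SymmetricAlgebra.ι ℂ V) ^ m
  lie_mem {x a} ha := by
    change ⁅x, a⁆ ∈ LinearMap.range (SymmetricAlgebra.ι ℂ V) ^ m
    change a ∈ LinearMap.range (SymmetricAlgebra.ι ℂ V) ^ m at ha
    induction m generalizing a with
    | zero =>
      rw [pow_zero, Submodule.mem_one] at ha
      obtain ⟨r, rfl⟩ := ha
      simp [lie_sym_eq]
    | succ m ih =>
      rw [pow_succ] at ha ⊢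
      induction ha using Submodule.mul_induction_on' with
      | mem_mul_mem a ha b hb =>
        obtain ⟨v, rfl⟩ := hb
        rw [lie_sym_mul, lie_sym_ι]
        exact add_mem (Submodule.mul_mem_mul ha ⟨_, rfl⟩) (Submodule.mul_mem_mul (ih ha) ⟨v, rfl⟩)
      | add a _ b _ ha hb =>
        rw [lie_add]
        exact add_mem ha hb

end SymmetricPowers

/-- `mult_L(W : V) = dim Hom_L(W, V)`. -/
def homDim (L W V : Type*) [LieRing L] [LieAlgebra ℂ L]
    [AddCommGroup W] [Module ℂ W] [LieRingModule L W] [LieModule ℂ L W]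
    [AddCommGroup V] [Module ℂ V] [LieRingModule L V] [LieModule ℂ L V] : ℕ :=
  finrank ℂ (W →ₗ⁅ℂ, L⁆ V)

/-- The Lie algebra `𝔰𝔩₂(ℂ)` of traceless `2 × 2` matrices; it acts on `ℂ²` by matrix-vector
multiplication. -/
abbrev sl2 : Type := LieAlgebra.SpecialLinear.sl (Fin 2) ℂ

/-- The representation `F_d = S^d(ℂ²)` of `𝔰𝔩₂(ℂ)`: the irreducible one of dimension `d + 1`. -/
abbrev F (d : ℕ) : LieSubmodule ℂ sl2 (SymmetricAlgebra ℂ (Fin 2 → ℂ)) :=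
  symPow sl2 (Fin 2 → ℂ) d

/-- The representation `S^m[S^d(ℂ²)]` of `𝔰𝔩₂(ℂ)`. -/
abbrev symSym (m d : ℕ) : LieSubmodule ℂ sl2 (SymmetricAlgebra ℂ (F d)) :=
  symPow sl2 (F d) m

/-- `a_j`, the multiplicity of `F_j` in `S^m[S^d(ℂ²)]`. -/
def mult (m d j : ℕ) : ℕ :=
  homDim sl2 (F j) (symSym m d)

/-- `ℓ(m, d)`: the least `j` with `a_j > 0`. -/
def ell (m d : ℕ) : ℕ :=
  sInf {j | 0 < mult m d j}

/-- The exceptional set. -/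
def E : Set (ℕ × ℕ) :=
  {(5, 6), (5, 10), (5, 14), (6, 7), (6, 9), (6, 11), (6, 13), (7, 10)}

end BinaryForms

end

/-! Monomials in a weight basis of `F d` diagonalise `h` on `S^m(F_d)`, so weight `m d - 2 k` has as
dimension the number of partitions of `k` in an `m × d` box. In a finite-dimensional module `e` maps
weight `j ≥ 0` onto weight `j + 2` (`exists_lie_e_eq`), and morphisms from `F j` correspond to
highest weight vectors. Hence, for `m d = j + 2 k`, `mult m d j` is the box count for `k` minus the
one for `k - 1` (`mult_add_boxCount`); for the wrong parity of `j` it is zero. Transposing the box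
gives Hermite reciprocity `mult_comm`.

Positivity spreads by multiplication: the symmetric algebra is a domain on which `sl2` acts by
derivations, so products of highest weight vectors are again nonzero highest weight vectors
(`mult_pos_add`). With reciprocity, an invariant enlarges either argument. For degrees at least 5
everything grows from a few counts: invariants at (2,2), (4,3), (5,18), (7,14), (9,10), (15,6) and
linear covariants at (5,5), (5,7), (7,7). The only pairs not reached are those of `E`, settled by
counting.

The remaining vanishing comes from parity or, for `d ≤ 3`, from closed forms for box counts; the
cubic case uses the Gaussian binomial (`boxCount_three_sub`). -/

noncomputable section

namespace BinaryForms

open Module LieModule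

attribute [local instance 100] LieRing.ofAssociativeRing

/-! ### Highest weight vectors in finite-dimensional modules over an `sl2` triple -/

section Sl2Modules

variable {L : Type*} [LieRing L] [LieAlgebra ℂ L]
variable {M : Type*} [AddCommGroup M] [Module ℂ M] [LieRingModule L M] [LieModule ℂ L M]
variable {h e f : L}

variable (M h) in
/-- The weight space of weight `μ` with respect to `h`. -/
def wtSpace (μ : ℂ) : Submodule ℂ M :=
  End.eigenspace (toEnd ℂ L M h) μ

theorem mem_wtSpace {μ : ℂ} {v : M} : v ∈ wtSpace M h μ ↔ ⁅h, v⁆ = μ • v := by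
  simp [wtSpace]

variable (M h e) in
/-- The space of highest weight vectors of weight `μ`. -/
def primSpace (μ : ℂ) : Submodule ℂ M :=
  wtSpace M h μ ⊓ LinearMap.ker (toEnd ℂ L M e : M →ₗ[ℂ] M)

theorem mem_primSpace {μ : ℂ} {v : M} :
    v ∈ primSpace M h e μ ↔ ⁅h, v⁆ = μ • v ∧ ⁅e, v⁆ = 0 := by
  simp [primSpace, mem_wtSpace]

theorem lie_e_mem_wtSpace (t : IsSl2Triple h e f) {μ : ℂ} {v : M} (hv : v ∈ wtSpace M h μ) :
    ⁅e, v⁆ ∈ wtSpace M h (μ + 2) := by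
  rw [mem_wtSpace] at hv ⊢
  rw [leibniz_lie, t.lie_h_e_smul ℂ, hv, lie_smul, smul_lie, ← add_smul, add_comm]

theorem lie_f_mem_wtSpace (t : IsSl2Triple h e f) {μ : ℂ} {v : M} (hv : v ∈ wtSpace M h μ) :
    ⁅f, v⁆ ∈ wtSpace M h (μ - 2) := by
  rw [mem_wtSpace] at hv ⊢
  rw [leibniz_lie, t.lie_lie_smul_f ℂ, hv, lie_smul, ← neg_smul, smul_lie, ← add_smul]
  ring_nf

theorem pow_e_mem_wtSpace (t : IsSl2Triple h e f) {μ : ℂ} {v : M} (hv : v ∈ wtSpace M h μ)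
    (k : ℕ) : (toEnd ℂ L M e ^ k) v ∈ wtSpace M h (μ + 2 * k) := by
  induction k with
  | zero => simpa using hv
  | succ k ih =>
    rw [pow_succ', End.mul_apply, toEnd_apply_apply]
    convert lie_e_mem_wtSpace t ih using 2
    push_cast
    ring

/-- Otherwise the vectors `e ^ k v` would be infinitely many eigenvectors of `h` with distinct
eigenvalues. -/
theorem exists_pow_e_eq_zero [FiniteDimensional ℂ M] (t : IsSl2Triple h e f) {μ : ℂ} {v : M}
    (hv : v ∈ wtSpace M h μ) : ∃ k : ℕ, (toEnd ℂ L M e ^ k) v = 0 := by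
  by_contra! contra
  have hinj : Function.Injective fun k : ℕ => μ + 2 * (k : ℂ) := fun a b hab => by
    simpa using hab
  have := End.eigenvectors_linearIndependent' (toEnd ℂ L M h) (fun k : ℕ => μ + 2 * (k : ℂ)) hinj
    (fun k => (toEnd ℂ L M e ^ k) v) fun k => ⟨pow_e_mem_wtSpace t hv k, contra k⟩
  exact not_finite_iff_infinite.2 inferInstance this.finite

/-- From `e f v = 0` one gets `f e ^ (k + 1) v = -(k + 1)(n + k) e ^ k v`. The scalar is nonzero for
`n ≥ 1`, so the vanishing of some `e ^ k v` descends to `v`. This replaces complete reducibility. -/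
theorem eq_zero_of_lie_e_lie_f_eq_zero [FiniteDimensional ℂ M] (t : IsSl2Triple h e f) {n : ℕ}
    (hn : 1 ≤ n) {v : M} (hv : v ∈ wtSpace M h n) (hef : ⁅e, ⁅f, v⁆⁆ = 0) : v = 0 := by
  have key (x : M) : ⁅f, ⁅e, x⁆⁆ = ⁅e, ⁅f, x⁆⁆ - ⁅h, x⁆ := by
    rw [leibniz_lie e f x, t.lie_e_f]
    abel
  have hfe (k : ℕ) : ⁅f, (toEnd ℂ L M e ^ (k + 1)) v⁆ =
      (-((k + 1) * (n + k)) : ℂ) • (toEnd ℂ L M e ^ k) v := by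
    induction k with
    | zero =>
      rw [mem_wtSpace] at hv
      simp [key, hef, hv]
    | succ k ih =>
      rw [pow_succ' _ (k + 1), End.mul_apply, toEnd_apply_apply, key, ih, lie_smul,
        mem_wtSpace.1 (pow_e_mem_wtSpace t hv (k + 1)), ← toEnd_apply_apply ℂ, ← End.mul_apply,
        ← pow_succ', ← sub_smul]
      congr 1
      push_cast
      ring
  obtain ⟨k, hk⟩ := exists_pow_e_eq_zero t hv
  induction k with
  | zero => simpa using hk
  | succ k ih =>
    apply ih
    have h0 := hfe k
    rw [hk, lie_zero, eq_comm, smul_eq_zero] at h0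
    refine h0.resolve_left ?_
    rw [neg_eq_zero]
    have : ((k + 1) * (n + k) : ℕ) ≠ 0 := by positivity
    exact_mod_cast this

/-- The operator `e f` is injective on the weight space of weight `j + 2 > 0`, hence bijective
there; if `e f x = v`, then `f x` is the preimage. -/
theorem exists_lie_e_eq [FiniteDimensional ℂ M] (t : IsSl2Triple h e f) {j : ℕ}
    {v : M} (hv : v ∈ wtSpace M h (j + 2)) : ∃ w ∈ wtSpace M h (j : ℂ), ⁅e, w⁆ = v := by
  let T : wtSpace M h (j + 2 : ℂ) →ₗ[ℂ] wtSpace M h (j + 2 : ℂ) :=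
    ((toEnd ℂ L M e : M →ₗ[ℂ] M) ∘ₗ (toEnd ℂ L M f : M →ₗ[ℂ] M)).restrict fun x hx => by
      simpa using lie_e_mem_wtSpace t (lie_f_mem_wtSpace t hx)
  have hT : Function.Injective T := by
    rw [injective_iff_map_eq_zero]
    rintro ⟨x, hx⟩ h0
    have h1 : ⁅e, ⁅f, x⁆⁆ = 0 := congrArg Subtype.val h0
    ext
    exact eq_zero_of_lie_e_lie_f_eq_zero (n := j + 2) t (by omega) (by exact_mod_cast hx) h1
  obtain ⟨⟨x, hx⟩, hxv⟩ := LinearMap.injective_iff_surjective.1 hT ⟨v, hv⟩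
  refine ⟨⁅f, x⁆, by simpa using lie_f_mem_wtSpace t hx, congrArg Subtype.val hxv⟩

/-- Rank-nullity for the surjection `e` between consecutive weight spaces. -/
theorem finrank_primSpace_add [FiniteDimensional ℂ M] (t : IsSl2Triple h e f) (j : ℕ) :
    finrank ℂ (primSpace M h e (j : ℂ)) + finrank ℂ (wtSpace M h (j + 2 : ℂ)) =
      finrank ℂ (wtSpace M h (j : ℂ)) := by
  let T : wtSpace M h (j : ℂ) →ₗ[ℂ] wtSpace M h (j + 2 : ℂ) :=
    (toEnd ℂ L M e : M →ₗ[ℂ] M).restrict fun x hx => lie_e_mem_wtSpace t hx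
  have hsurj : LinearMap.range T = ⊤ := by
    rw [LinearMap.range_eq_top]
    rintro ⟨v, hv⟩
    obtain ⟨w, hw, hwv⟩ := exists_lie_e_eq t hv
    exact ⟨⟨w, hw⟩, Subtype.ext hwv⟩
  have hker : finrank ℂ (LinearMap.ker T) = finrank ℂ (primSpace M h e (j : ℂ)) := by
    have : primSpace M h e (j : ℂ) = (LinearMap.ker T).map (wtSpace M h (j : ℂ)).subtype := by
      ext v
      simp only [primSpace, Submodule.mem_inf, LinearMap.mem_ker, Submodule.mem_map]
      constructor
      · rintro ⟨h1, h2⟩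
        exact ⟨⟨v, h1⟩, Subtype.ext h2, rfl⟩
      · rintro ⟨w, h1, rfl⟩
        exact ⟨w.2, congrArg Subtype.val h1⟩
    rw [this]
    exact (LinearEquiv.finrank_eq
      (Submodule.equivMapOfInjective _ (Submodule.injective_subtype _) _))
  have := LinearMap.finrank_range_add_finrank_ker T
  rw [hsurj, finrank_top, hker] at this
  omega

variable {W : Type*} [AddCommGroup W] [Module ℂ W] [LieRingModule L W] [LieModule ℂ L W]

/-- The basis of weight vectors `f ^ k u` of an irreducible representation with highest weight
vector `u`. -/
def primBasis [FiniteDimensional ℂ W] {t : IsSl2Triple h e f} {u : W} {j : ℕ}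
    (hu : t.HasPrimitiveVectorWith u (j : ℂ)) (hW : finrank ℂ W = j + 1) :
    Basis (Fin (j + 1)) ℂ W :=
  basisOfLinearIndependentOfCardEqFinrank (b := fun k : Fin (j + 1) => (toEnd ℂ L W f ^ (k : ℕ)) u)
    (End.eigenvectors_linearIndependent' (toEnd ℂ L W h) (fun k : Fin (j + 1) => (j - 2 * (k : ℕ) : ℂ))
      (fun a b hab => by
        have : (a : ℕ) = (b : ℕ) := by simpa using hab
        exact Fin.ext this) _
      fun k => ⟨mem_wtSpace.2 (hu.lie_h_pow_toEnd_f k),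
        hu.pow_toEnd_f_ne_zero_of_eq_nat rfl (Nat.lt_succ_iff.1 k.2)⟩)
    (by simp [hW])

theorem primBasis_apply [FiniteDimensional ℂ W] {t : IsSl2Triple h e f} {u : W} {j : ℕ}
    (hu : t.HasPrimitiveVectorWith u (j : ℂ)) (hW : finrank ℂ W = j + 1) (k : Fin (j + 1)) :
    primBasis hu hW k = (toEnd ℂ L W f ^ (k : ℕ)) u := by
  simp [primBasis]

theorem map_pow_toEnd (φ : W →ₗ⁅ℂ, L⁆ M) (x : L) (k : ℕ) (w : W) :
    φ ((toEnd ℂ L W x ^ k) w) = (toEnd ℂ L M x ^ k) (φ w) := by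
  induction k with
  | zero => simp
  | succ k ih => simp [pow_succ', ih]

/-- A highest weight vector of weight `j` is the image of `u` under a morphism. -/
theorem exists_hom_apply_eq [FiniteDimensional ℂ W] [FiniteDimensional ℂ M]
    {t : IsSl2Triple h e f} (ht : ∀ x : L, ∃ a b c : ℂ, x = a • h + b • e + c • f)
    {u : W} {j : ℕ} (hu : t.HasPrimitiveVectorWith u (j : ℂ)) (hW : finrank ℂ W = j + 1)
    {v : M} (hv : t.HasPrimitiveVectorWith v (j : ℂ)) :
    ∃ φ : W →ₗ⁅ℂ, L⁆ M, φ u = v := by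
  let T : W →ₗ[ℂ] M := (primBasis hu hW).constr ℂ fun k => (toEnd ℂ L M f ^ (k : ℕ)) v
  -- Beyond `k = j` both sides vanish, so the formula holds for every `k` and compatibility with `f`
  -- needs no special case at the lowest weight.
  have hT (k : ℕ) : T ((toEnd ℂ L W f ^ k) u) = (toEnd ℂ L M f ^ k) v := by
    by_cases hk : k < j + 1
    · have := (primBasis hu hW).constr_basis ℂ (fun k => (toEnd ℂ L M f ^ (k : ℕ)) v) ⟨k, hk⟩
      rwa [primBasis_apply] at this
    · obtain ⟨i, rfl⟩ := Nat.exists_eq_add_of_le' (not_lt.1 hk)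
      rw [pow_add _ i, pow_add _ i, End.mul_apply, End.mul_apply, hu.pow_toEnd_f_eq_zero_of_eq_nat rfl,
        hv.pow_toEnd_f_eq_zero_of_eq_nat rfl]
      simp
  have comm (x : L) (hx : ∀ k : ℕ, T ⁅x, (toEnd ℂ L W f ^ k) u⁆ = ⁅x, (toEnd ℂ L M f ^ k) v⁆)
      (w : W) : T ⁅x, w⁆ = ⁅x, T w⁆ := by
    have : T ∘ₗ (toEnd ℂ L W x : W →ₗ[ℂ] W) = (toEnd ℂ L M x : M →ₗ[ℂ] M) ∘ₗ T := by
      refine (primBasis hu hW).ext fun k => ?_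
      simp only [primBasis_apply, LinearMap.comp_apply, toEnd_apply_apply, hx, hT]
    exact LinearMap.congr_fun this w
  have hf := comm f fun k => by
    rw [hu.lie_f_pow_toEnd_f, hv.lie_f_pow_toEnd_f, hT]
  have hh := comm h fun k => by
    rw [hu.lie_h_pow_toEnd_f, hv.lie_h_pow_toEnd_f, map_smul, hT]
  have he := comm e fun k => by
    cases k with
    | zero => simp [hu.lie_e, hv.lie_e]
    | succ k => rw [hu.lie_e_pow_succ_toEnd_f, hv.lie_e_pow_succ_toEnd_f, map_smul, hT]
  refine ⟨{ T with map_lie' := ?_ }, hT 0⟩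
  intro x w
  obtain ⟨a, b, c, rfl⟩ := ht x
  simp [add_lie, smul_lie, hf, hh, he]

/-- Evaluation at the highest weight vector identifies morphisms with highest weight vectors. -/
theorem homDim_eq_finrank_primSpace [FiniteDimensional ℂ W] [FiniteDimensional ℂ M]
    {t : IsSl2Triple h e f} (ht : ∀ x : L, ∃ a b c : ℂ, x = a • h + b • e + c • f)
    {u : W} {j : ℕ} (hu : t.HasPrimitiveVectorWith u (j : ℂ)) (hW : finrank ℂ W = j + 1) :
    homDim L W M = finrank ℂ (primSpace M h e (j : ℂ)) := by
  let ev : (W →ₗ⁅ℂ, L⁆ M) →ₗ[ℂ] primSpace M h e (j : ℂ) :=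
    { toFun := fun φ => ⟨φ u, mem_primSpace.2 ⟨by
        rw [← LieModuleHom.map_lie, hu.lie_h, map_smul], by
        rw [← LieModuleHom.map_lie, hu.lie_e, map_zero]⟩⟩
      map_add' := fun φ ψ => rfl
      map_smul' := fun c φ => rfl }
  refine LinearEquiv.finrank_eq (LinearEquiv.ofBijective ev ⟨?_, ?_⟩)
  · rw [injective_iff_map_eq_zero]
    intro φ hφ
    have h0 : φ u = 0 := congrArg Subtype.val hφ
    have : (φ : W →ₗ[ℂ] M) = 0 := by
      refine (primBasis hu hW).ext fun k => ?_
      rw [primBasis_apply]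
      change φ _ = _
      rw [map_pow_toEnd, h0]
      simp
    ext w
    exact LinearMap.congr_fun this w
  · rintro ⟨v, hv⟩
    by_cases h0 : v = 0
    · subst h0
      exact ⟨0, rfl⟩
    · rw [mem_primSpace] at hv
      obtain ⟨φ, hφ⟩ := exists_hom_apply_eq ht hu hW (v := v) ⟨h0, hv.1, hv.2⟩
      exact ⟨φ, Subtype.ext hφ⟩

end Sl2Modules

/-! ### Monomial bases and weights of symmetric powers -/

section SymmetricPowerWeights

variable {L : Type*} [LieRing L] [LieAlgebra ℂ L]
variable {V : Type*} [AddCommGroup V] [Module ℂ V] [LieRingModule L V] [LieModule ℂ L V]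
variable {I : Type*}

theorem basis_symmetricAlgebra_add (b : Basis I ℂ V) (s t : I →₀ ℕ) :
    b.symmetricAlgebra (s + t) = b.symmetricAlgebra s * b.symmetricAlgebra t := by
  simp [Basis.symmetricAlgebra, ← map_mul, MvPolynomial.monomial_mul]

theorem basis_symmetricAlgebra_zero (b : Basis I ℂ V) : b.symmetricAlgebra 0 = 1 := by
  simp [Basis.symmetricAlgebra]

theorem basis_symmetricAlgebra_single (b : Basis I ℂ V) (i : I) :
    b.symmetricAlgebra (Finsupp.single i 1) = SymmetricAlgebra.ι ℂ V (b i) := by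
  simp [Basis.symmetricAlgebra, ← SymmetricAlgebra.equivMvPolynomial_symm_X, MvPolynomial.X]

theorem mem_symPow {m : ℕ} {a : SymmetricAlgebra ℂ V} :
    a ∈ symPow L V m ↔ a ∈ LinearMap.range (SymmetricAlgebra.ι ℂ V) ^ m := Iff.rfl

theorem mul_mem_symPow {m n : ℕ} {a b : SymmetricAlgebra ℂ V} (ha : a ∈ symPow L V m)
    (hb : b ∈ symPow L V n) : a * b ∈ symPow L V (m + n) := by
  rw [mem_symPow] at *
  rw [pow_add]
  exact Submodule.mul_mem_mul ha hb

theorem lie_sym_one (x : L) : ⁅x, (1 : SymmetricAlgebra ℂ V)⁆ = 0 := by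
  simp [lie_sym_eq]

theorem lie_basis_symmetricAlgebra (b : Basis I ℂ V) (x : L) (w : I → ℂ)
    (hw : ∀ i, ⁅x, b i⁆ = w i • b i) (s : I →₀ ℕ) :
    ⁅x, b.symmetricAlgebra s⁆ = Finsupp.linearCombination ℕ w s • b.symmetricAlgebra s := by
  induction s using Finsupp.induction_linear with
  | zero => simp [basis_symmetricAlgebra_zero, lie_sym_one]
  | add s t hs ht =>
    rw [basis_symmetricAlgebra_add, lie_sym_mul, hs, ht, map_add, add_smul, smul_mul_assoc,
      mul_smul_comm, add_comm]
  | single i n =>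
    induction n with
    | zero => simp [basis_symmetricAlgebra_zero, lie_sym_one]
    | succ n ih =>
      rw [Finsupp.single_add, basis_symmetricAlgebra_add, lie_sym_mul, ih, map_add, add_smul,
        smul_mul_assoc, basis_symmetricAlgebra_single, lie_sym_ι, hw, map_smul, mul_smul_comm,
        add_comm]
      simp

theorem repr_lie_symmetricAlgebra (b : Basis I ℂ V) (x : L) (w : I → ℂ)
    (hw : ∀ i, ⁅x, b i⁆ = w i • b i) (a : SymmetricAlgebra ℂ V) (s : I →₀ ℕ) :
    b.symmetricAlgebra.repr ⁅x, a⁆ s =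
      Finsupp.linearCombination ℕ w s * b.symmetricAlgebra.repr a s := by
  have : (Finsupp.lapply s ∘ₗ b.symmetricAlgebra.repr.toLinearMap) ∘ₗ
        (toEnd ℂ L (SymmetricAlgebra ℂ V) x : SymmetricAlgebra ℂ V →ₗ[ℂ] SymmetricAlgebra ℂ V) =
      Finsupp.linearCombination ℕ w s • (Finsupp.lapply s ∘ₗ b.symmetricAlgebra.repr.toLinearMap) := by
    refine b.symmetricAlgebra.ext fun t => ?_
    simp only [LinearMap.comp_apply, toEnd_apply_apply, lie_basis_symmetricAlgebra b x w hw,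
      LinearMap.smul_apply, map_smul, LinearEquiv.coe_coe, Basis.repr_self, Finsupp.lapply_apply]
    by_cases h : t = s
    · rw [h]
    · simp [h]
  exact LinearMap.congr_fun this a

/-- Under the isomorphism with polynomials the range of `ι` becomes the space of linear forms, whose
powers are the homogeneous components. -/
theorem mem_symPow_iff_repr (b : Basis I ℂ V) {m : ℕ} {a : SymmetricAlgebra ℂ V} :
    a ∈ symPow L V m ↔ ∀ s, b.symmetricAlgebra.repr a s ≠ 0 → s.degree = m := by
  rw [mem_symPow]
  let E := SymmetricAlgebra.equivMvPolynomial b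
  have h1 : (LinearMap.range (SymmetricAlgebra.ι ℂ V)).map E.toAlgHom.toLinearMap =
      MvPolynomial.homogeneousSubmodule I ℂ 1 := by
    rw [MvPolynomial.homogeneousSubmodule_one_eq_span_X, ← Submodule.map_top, ← b.span_eq,
      Submodule.map_span, Submodule.map_span, ← Set.range_comp, ← Set.range_comp]
    congr 1
    ext p
    simp [E]
  have h2 : a ∈ LinearMap.range (SymmetricAlgebra.ι ℂ V) ^ m ↔
      E a ∈ MvPolynomial.homogeneousSubmodule I ℂ m := by
    rw [← MvPolynomial.homogeneousSubmodule_one_pow, ← h1, ← Submodule.map_pow]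
    constructor
    · intro h
      exact ⟨a, h, rfl⟩
    · rintro ⟨c, hc, hca⟩
      have : c = a := E.injective hca
      exact this ▸ hc
  rw [h2, MvPolynomial.mem_homogeneousSubmodule]
  refine forall_congr' fun s => ?_
  rw [Finsupp.degree_eq_weight_one]
  rfl

instance finiteDimensional_symPow [FiniteDimensional ℂ V] (m : ℕ) :
    FiniteDimensional ℂ (symPow L V m) := by
  have : ((LinearMap.range (SymmetricAlgebra.ι ℂ V)) ^ m).FG :=
    Submodule.FG.pow (Module.Finite.iff_fg.1 inferInstance) m
  exact Module.Finite.iff_fg.2 this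

/-- Symmetric powers and their weight spaces are both spans of monomials, so this turns their
dimensions into cardinalities. -/
theorem finrank_comap_supported {J A : Type*} [AddCommGroup A] [Module ℂ A] (b : Basis J ℂ A)
    (S : Set J) :
    finrank ℂ ((Finsupp.supported ℂ ℂ S).comap b.repr.toLinearMap) = Nat.card S := by
  have h : (Finsupp.supported ℂ ℂ S).comap b.repr.toLinearMap =
      (Finsupp.supported ℂ ℂ S).map b.repr.symm.toLinearMap := by
    exact (Submodule.map_equiv_eq_comap_symm b.repr.symm _).symm
  rw [h, ← (b.repr.symm.submoduleMap (Finsupp.supported ℂ ℂ S)).finrank_eq, finrank_eq_nat_card_basis ((Finsupp.basisSingleOne (R := ℂ)).map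
    (Finsupp.supportedEquivFinsupp (M := ℂ) (R := ℂ) S).symm)]

/-- The dimension of a weight space of a symmetric power is the number of monomials of this
weight. -/
theorem finrank_wtSpace_symPow (b : Basis I ℂ V) (x : L) (w : I → ℂ)
    (hw : ∀ i, ⁅x, b i⁆ = w i • b i) (m : ℕ) (μ : ℂ) :
    finrank ℂ (wtSpace (symPow L V m) x μ) =
      Nat.card {s : I →₀ ℕ | s.degree = m ∧ Finsupp.linearCombination ℕ w s = μ} := by
  rw [← finrank_comap_supported b.symmetricAlgebra]
  have : (wtSpace (symPow L V m) x μ).map (symPow L V m).toSubmodule.subtype =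
      (Finsupp.supported ℂ ℂ {s : I →₀ ℕ | s.degree = m ∧
        Finsupp.linearCombination ℕ w s = μ}).comap b.symmetricAlgebra.repr.toLinearMap := by
    ext a
    simp only [Submodule.mem_map, Submodule.mem_comap, Finsupp.mem_supported']
    constructor
    · rintro ⟨⟨a, ha⟩, h, rfl⟩ s hs
      have h1 : ⁅x, a⁆ = μ • a :=
        congrArg Subtype.val (mem_wtSpace (v := (⟨a, ha⟩ : symPow L V m)).1 h)
      have h2 := repr_lie_symmetricAlgebra b x w hw a s
      by_contra h0
      refine hs ⟨(mem_symPow_iff_repr b).1 ha s h0, ?_⟩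
      rw [h1, map_smul, Finsupp.smul_apply, smul_eq_mul] at h2
      exact (mul_right_cancel₀ h0 h2).symm
    · intro h
      have ha : a ∈ symPow L V m := (mem_symPow_iff_repr b).2 fun s hs => by
        by_contra hd
        exact hs (h s fun hc => hd hc.1)
      suffices hmem : (⟨a, ha⟩ : symPow L V m) ∈ wtSpace (symPow L V m) x μ from ⟨_, hmem, rfl⟩
      refine mem_wtSpace.2 (Subtype.ext ?_)
      change ⁅x, a⁆ = μ • a
      refine b.symmetricAlgebra.ext_elem fun s => ?_
      rw [repr_lie_symmetricAlgebra b x w hw, map_smul, Finsupp.smul_apply, smul_eq_mul]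
      by_cases hs : Finsupp.linearCombination ℕ w s = μ
      · rw [hs]
      · have : b.symmetricAlgebra.repr a s = 0 := h s fun hc => hs hc.2
        rw [this, mul_zero, mul_zero]
  rw [← this]
  exact LinearEquiv.finrank_eq (Submodule.equivMapOfInjective _ (Submodule.injective_subtype _) _)

theorem finrank_symPow (b : Basis I ℂ V) (m : ℕ) :
    finrank ℂ (symPow L V m) = Nat.card {s : I →₀ ℕ | s.degree = m} := by
  rw [← finrank_comap_supported b.symmetricAlgebra]
  have : (symPow L V m).toSubmodule = (Finsupp.supported ℂ ℂ {s : I →₀ ℕ | s.degree = m}).comap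
      b.symmetricAlgebra.repr.toLinearMap := by
    ext a
    change a ∈ symPow L V m ↔ _
    rw [mem_symPow_iff_repr b, Submodule.mem_comap, Finsupp.mem_supported']
    exact forall_congr' fun s => not_imp_comm
  rw [← this]
  rfl

theorem finrank_symPow_fin_two (b : Basis (Fin 2) ℂ V) (d : ℕ) :
    finrank ℂ (symPow L V d) = d + 1 := by
  rw [finrank_symPow b]
  have : {s : Fin 2 →₀ ℕ | s.degree = d} =
      ((Finset.univ : Finset (Fin 2)).finsuppAntidiag d : Set (Fin 2 →₀ ℕ)) := by
    ext s
    simp [Finset.mem_finsuppAntidiag, Finsupp.degree_eq_sum]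
  rw [this, Nat.card_eq_fintype_card]
  simp only [Finset.coe_sort_coe, Fintype.card_coe]
  rw [Finset.card_finsuppAntidiag_nat_eq_choose]
  simp [show 2 + d - 1 = d + 1 by omega]

theorem lie_pow_eq_zero {x : L} {v : V} (hv : ⁅x, v⁆ = 0) (d : ℕ) :
    ⁅x, SymmetricAlgebra.ι ℂ V v ^ d⁆ = 0 := by
  induction d with
  | zero => rw [pow_zero, lie_sym_one]
  | succ d ih => rw [pow_succ, lie_sym_mul, ih, lie_sym_ι, hv]; simp

theorem lie_pow_eq_smul {x : L} {v : V} (hv : ⁅x, v⁆ = v) (d : ℕ) :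
    ⁅x, SymmetricAlgebra.ι ℂ V v ^ d⁆ = (d : ℂ) • SymmetricAlgebra.ι ℂ V v ^ d := by
  induction d with
  | zero => rw [pow_zero, lie_sym_one]; simp
  | succ d ih =>
    rw [pow_succ, lie_sym_mul, ih, lie_sym_ι, hv, smul_mul_assoc, Nat.cast_succ, add_smul,
      one_smul, add_comm]

/-- If `b i` is a highest weight vector of weight `1` then `b i ^ d` is one of weight `d`. -/
theorem exists_hasPrimitiveVectorWith_symPow {h e f : L} (t : IsSl2Triple h e f)
    (b : Basis I ℂ V) (i : I) (hh : ⁅h, b i⁆ = b i) (he : ⁅e, b i⁆ = 0) (d : ℕ) :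
    ∃ u : symPow L V d, t.HasPrimitiveVectorWith u (d : ℂ) := by
  have hd : SymmetricAlgebra.ι ℂ V (b i) ^ d ∈ symPow L V d :=
    mem_symPow.2 (Submodule.pow_mem_pow _ (LinearMap.mem_range_self _ _) d)
  refine ⟨⟨_, hd⟩, fun h0 => ?_, Subtype.ext (lie_pow_eq_smul hh d),
    Subtype.ext (lie_pow_eq_zero he d)⟩
  have h1 : SymmetricAlgebra.ι ℂ V (b i) ^ d = 0 := congrArg Subtype.val h0
  have h2 := eq_zero_of_pow_eq_zero h1
  rw [← basis_symmetricAlgebra_single] at h2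
  exact b.symmetricAlgebra.ne_zero _ h2

/-! ### Multiplicities in symmetric powers -/

section Multiplicities

variable {h e f : L}
variable {W : Type*} [AddCommGroup W] [Module ℂ W] [LieRingModule L W] [LieModule ℂ L W]
  [FiniteDimensional ℂ W]

/-- The vector is taken in the ambient symmetric algebra, where vectors from different powers can be
multiplied. -/
theorem homDim_symPow_pos_iff [FiniteDimensional ℂ V] {t : IsSl2Triple h e f}
    (ht : ∀ x : L, ∃ a b c : ℂ, x = a • h + b • e + c • f)
    {u : W} {j : ℕ} (hu : t.HasPrimitiveVectorWith u (j : ℂ)) (hW : finrank ℂ W = j + 1) {m : ℕ} :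
    0 < homDim L W (symPow L V m) ↔
      ∃ a ∈ symPow L V m, a ≠ 0 ∧ ⁅h, a⁆ = (j : ℂ) • a ∧ ⁅e, a⁆ = 0 := by
  rw [homDim_eq_finrank_primSpace ht hu hW, Module.finrank_pos_iff, Submodule.nontrivial_iff_ne_bot,
    Submodule.ne_bot_iff]
  constructor
  · rintro ⟨a, ha, h0⟩
    rw [mem_primSpace] at ha
    exact ⟨a.1, a.2, fun h => h0 (Subtype.ext h), congrArg Subtype.val ha.1,
      congrArg Subtype.val ha.2⟩
  · rintro ⟨a, ha, h0, h1, h2⟩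
    exact ⟨⟨a, ha⟩, mem_primSpace.2 ⟨Subtype.ext h1, Subtype.ext h2⟩,
      fun h => h0 (congrArg Subtype.val h)⟩

/-- The product of two highest weight vectors of a symmetric algebra is a highest weight vector. -/
theorem exists_highestWeight_mul {m n i j : ℕ}
    (hm : ∃ a ∈ symPow L V m, a ≠ 0 ∧ ⁅h, a⁆ = (i : ℂ) • a ∧ ⁅e, a⁆ = 0)
    (hn : ∃ a ∈ symPow L V n, a ≠ 0 ∧ ⁅h, a⁆ = (j : ℂ) • a ∧ ⁅e, a⁆ = 0) :
    ∃ a ∈ symPow L V (m + n), a ≠ 0 ∧ ⁅h, a⁆ = ((i + j : ℕ) : ℂ) • a ∧ ⁅e, a⁆ = 0 := by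
  obtain ⟨a, ha, ha0, hah, hae⟩ := hm
  obtain ⟨b, hb, hb0, hbh, hbe⟩ := hn
  refine ⟨a * b, mul_mem_symPow ha hb, mul_ne_zero ha0 hb0, ?_, ?_⟩
  · rw [lie_sym_mul, hah, hbh, mul_smul_comm, smul_mul_assoc, ← add_smul, add_comm]
    push_cast
    rfl
  · rw [lie_sym_mul, hae, hbe, mul_zero, zero_mul, add_zero]

/-- The exponents of the monomials of degree `m` in `d + 1` variables of weights `0, …, d` that
have weight `k`. -/
def boxSet (m d k : ℕ) : Set (Fin (d + 1) → ℕ) :=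
  {s | ∑ i, s i = m ∧ ∑ i, s i * (i : ℕ) = k}

theorem finrank_wtSpace_symPow_fin {d : ℕ} (b : Basis (Fin (d + 1)) ℂ V) (x : L)
    (hb : ∀ i, ⁅x, b i⁆ = (d - 2 * (i : ℕ) : ℂ) • b i) (m : ℕ) (μ : ℂ) :
    finrank ℂ (wtSpace (symPow L V m) x μ) =
      Nat.card {s : Fin (d + 1) → ℕ |
        ∑ i, s i = m ∧ (m * d : ℂ) - 2 * (∑ i, s i * (i : ℕ) : ℕ) = μ} := by
  rw [finrank_wtSpace_symPow b x (fun i => (d - 2 * (i : ℕ) : ℂ)) hb]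
  refine Nat.card_congr (Finsupp.equivFunOnFinite.subtypeEquiv fun s => ?_)
  simp only [Set.mem_ofPred_eq, Finsupp.degree_eq_sum, Finsupp.equivFunOnFinite_apply]
  refine and_congr_right fun hs => ?_
  have : Finsupp.linearCombination ℕ (fun i : Fin (d + 1) => (d - 2 * (i : ℕ) : ℂ)) s =
      (m * d : ℂ) - 2 * (∑ i, s i * (i : ℕ) : ℕ) := by
    rw [Finsupp.linearCombination_apply, Finsupp.sum_fintype _ _ (by simp), ← hs]
    push_cast
    rw [Finset.sum_mul, Finset.mul_sum, ← Finset.sum_sub_distrib]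
    refine Finset.sum_congr rfl fun i _ => ?_
    rw [nsmul_eq_mul]
    ring
  rw [this]

theorem finrank_wtSpace_symPow_eq_card_boxSet {d : ℕ} (b : Basis (Fin (d + 1)) ℂ V) (x : L)
    (hb : ∀ i, ⁅x, b i⁆ = (d - 2 * (i : ℕ) : ℂ) • b i) {m j k : ℕ} (hk : m * d = j + 2 * k) :
    finrank ℂ (wtSpace (symPow L V m) x (j : ℂ)) = Nat.card (boxSet m d k) := by
  rw [finrank_wtSpace_symPow_fin b x hb]
  congr 2
  ext s
  refine and_congr_right fun _ => ?_
  rw [sub_eq_iff_eq_add]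
  norm_cast
  omega

theorem finrank_wtSpace_symPow_eq_zero {d : ℕ} (b : Basis (Fin (d + 1)) ℂ V) (x : L)
    (hb : ∀ i, ⁅x, b i⁆ = (d - 2 * (i : ℕ) : ℂ) • b i) {m j : ℕ} (hk : ∀ k, m * d ≠ j + 2 * k) :
    finrank ℂ (wtSpace (symPow L V m) x (j : ℂ)) = 0 := by
  rw [finrank_wtSpace_symPow_fin b x hb]
  have : {s : Fin (d + 1) → ℕ |
      ∑ i, s i = m ∧ (m * d : ℂ) - 2 * (∑ i, s i * (i : ℕ) : ℕ) = j} = ∅ := by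
    rw [Set.eq_empty_iff_forall_notMem]
    rintro s ⟨-, hs⟩
    rw [sub_eq_iff_eq_add] at hs
    exact hk _ (by exact_mod_cast hs)
  rw [this]
  simp

/-- The multiplicities of a symmetric power as differences of numbers of monomials. -/
theorem homDim_symPow_add_card [FiniteDimensional ℂ V] {t : IsSl2Triple h e f}
    (ht : ∀ x : L, ∃ a b c : ℂ, x = a • h + b • e + c • f)
    {u : W} {j : ℕ} (hu : t.HasPrimitiveVectorWith u (j : ℂ)) (hW : finrank ℂ W = j + 1)
    {d : ℕ} (b : Basis (Fin (d + 1)) ℂ V) (hb : ∀ i, ⁅h, b i⁆ = (d - 2 * (i : ℕ) : ℂ) • b i)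
    {m k : ℕ} (hk : m * d = j + 2 * k) :
    homDim L W (symPow L V m) + (if k = 0 then 0 else Nat.card (boxSet m d (k - 1))) =
      Nat.card (boxSet m d k) := by
  rw [homDim_eq_finrank_primSpace ht hu hW, ← finrank_wtSpace_symPow_eq_card_boxSet b h hb hk,
    ← finrank_primSpace_add t]
  congr 1
  have hcast : (j + 2 : ℂ) = ((j + 2 : ℕ) : ℂ) := by push_cast; rfl
  rw [hcast]
  -- For `k = 0` the weight `j + 2` exceeds the top weight `m d`, so its space is zero.
  split_ifs with h0
  · rw [finrank_wtSpace_symPow_eq_zero b h hb]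
    omega
  · rw [finrank_wtSpace_symPow_eq_card_boxSet b h hb]
    omega

theorem homDim_symPow_eq_zero [FiniteDimensional ℂ V] {t : IsSl2Triple h e f}
    (ht : ∀ x : L, ∃ a b c : ℂ, x = a • h + b • e + c • f)
    {u : W} {j : ℕ} (hu : t.HasPrimitiveVectorWith u (j : ℂ)) (hW : finrank ℂ W = j + 1)
    {d : ℕ} (b : Basis (Fin (d + 1)) ℂ V) (hb : ∀ i, ⁅h, b i⁆ = (d - 2 * (i : ℕ) : ℂ) • b i)
    {m : ℕ} (hk : ∀ k, m * d ≠ j + 2 * k) : homDim L W (symPow L V m) = 0 := by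
  have := finrank_primSpace_add (M := symPow L V m) t j
  rw [finrank_wtSpace_symPow_eq_zero b h hb hk] at this
  rw [homDim_eq_finrank_primSpace ht hu hW]
  omega

end Multiplicities

end SymmetricPowerWeights

/-! ### The case of `sl2` and the representations `F d` -/

section Sl2

/-- The diagonal element of the standard triple of `𝔰𝔩₂(ℂ)`. -/
def sl2H : sl2 := ⟨!![1, 0; 0, -1], by
  change Matrix.trace (!![1, 0; 0, -1] : Matrix (Fin 2) (Fin 2) ℂ) = 0
  simp [Matrix.trace_fin_two]⟩

/-- The raising element of the standard triple of `𝔰𝔩₂(ℂ)`. -/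
def sl2E : sl2 := ⟨!![0, 1; 0, 0], by
  change Matrix.trace (!![0, 1; 0, 0] : Matrix (Fin 2) (Fin 2) ℂ) = 0
  simp [Matrix.trace_fin_two]⟩

/-- The lowering element of the standard triple of `𝔰𝔩₂(ℂ)`. -/
def sl2F : sl2 := ⟨!![0, 0; 1, 0], by
  change Matrix.trace (!![0, 0; 1, 0] : Matrix (Fin 2) (Fin 2) ℂ) = 0
  simp [Matrix.trace_fin_two]⟩

theorem isSl2Triple_sl2 : IsSl2Triple sl2H sl2E sl2F where
  h_ne_zero := fun h => by
    have := congrFun (congrFun (congrArg Subtype.val h) 0) 0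
    simp [sl2H] at this
  lie_e_f := by
    apply Subtype.ext
    rw [LieAlgebra.SpecialLinear.sl_bracket]
    ext i j
    fin_cases i <;> fin_cases j <;> simp [sl2H, sl2E, sl2F]
  lie_h_e_nsmul := by
    apply Subtype.ext
    rw [LieAlgebra.SpecialLinear.sl_bracket]
    ext i j
    fin_cases i <;> fin_cases j <;> simp [sl2H, sl2E, two_smul]
  lie_h_f_nsmul := by
    apply Subtype.ext
    rw [LieAlgebra.SpecialLinear.sl_bracket]
    ext i j
    fin_cases i <;> fin_cases j <;> simp [sl2H, sl2F, two_smul]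
    norm_num

theorem sl2_eq_combination (x : sl2) : ∃ a b c : ℂ, x = a • sl2H + b • sl2E + c • sl2F := by
  refine ⟨x.1 0 0, x.1 0 1, x.1 1 0, ?_⟩
  have hx : Matrix.trace x.1 = 0 := x.2
  rw [Matrix.trace_fin_two] at hx
  apply Subtype.ext
  ext i j
  fin_cases i <;> fin_cases j <;> simp [sl2H, sl2E, sl2F]
  linear_combination hx

theorem sl2H_lie_basisFun :
    ⁅sl2H, Pi.basisFun ℂ (Fin 2) 0⁆ = Pi.basisFun ℂ (Fin 2) 0 := by
  change (sl2H : Matrix (Fin 2) (Fin 2) ℂ).mulVec _ = _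
  ext k
  fin_cases k <;> simp [sl2H]

theorem sl2E_lie_basisFun : ⁅sl2E, Pi.basisFun ℂ (Fin 2) 0⁆ = 0 := by
  change (sl2E : Matrix (Fin 2) (Fin 2) ℂ).mulVec _ = _
  ext k
  fin_cases k <;> simp [sl2E]

theorem finrank_F (d : ℕ) : finrank ℂ (F d) = d + 1 :=
  finrank_symPow_fin_two (L := sl2) (V := Fin 2 → ℂ) (Pi.basisFun ℂ (Fin 2)) d

theorem exists_hasPrimitiveVectorWith_F (d : ℕ) :
    ∃ u : F d, isSl2Triple_sl2.HasPrimitiveVectorWith u (d : ℂ) :=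
  exists_hasPrimitiveVectorWith_symPow (V := Fin 2 → ℂ) isSl2Triple_sl2
    (Pi.basisFun ℂ (Fin 2)) 0 sl2H_lie_basisFun sl2E_lie_basisFun d

instance finiteDimensional_F (d : ℕ) : FiniteDimensional ℂ (F d) :=
  finiteDimensional_symPow (L := sl2) (V := Fin 2 → ℂ) d

/-- The basis `f ^ k u` of `F d`. -/
theorem exists_basis_F (d : ℕ) : ∃ b : Basis (Fin (d + 1)) ℂ (F d),
    ∀ i, ⁅sl2H, b i⁆ = (d - 2 * (i : ℕ) : ℂ) • b i := by
  obtain ⟨u, hu⟩ := exists_hasPrimitiveVectorWith_F d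
  exact ⟨primBasis hu (finrank_F d), fun i => by
    rw [primBasis_apply, hu.lie_h_pow_toEnd_f]⟩

theorem mult_eq_homDim (m d j : ℕ) :
    mult m d j = homDim sl2 (F j) (symPow sl2 (F d) m) := rfl

theorem mult_add_card {m d j k : ℕ} (hk : m * d = j + 2 * k) :
    mult m d j + (if k = 0 then 0 else Nat.card (boxSet m d (k - 1))) =
      Nat.card (boxSet m d k) := by
  obtain ⟨u, hu⟩ := exists_hasPrimitiveVectorWith_F j
  obtain ⟨b, hb⟩ := exists_basis_F d
  rw [mult_eq_homDim]
  exact homDim_symPow_add_card sl2_eq_combination hu (finrank_F j) b hb hk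

theorem mult_eq_zero {m d j : ℕ} (hk : ∀ k, m * d ≠ j + 2 * k) : mult m d j = 0 := by
  obtain ⟨u, hu⟩ := exists_hasPrimitiveVectorWith_F j
  obtain ⟨b, hb⟩ := exists_basis_F d
  rw [mult_eq_homDim]
  exact homDim_symPow_eq_zero sl2_eq_combination hu (finrank_F j) b hb hk

theorem mult_pos_iff {m d j : ℕ} : 0 < mult m d j ↔
    ∃ a ∈ symPow sl2 (F d) m, a ≠ 0 ∧ ⁅sl2H, a⁆ = (j : ℂ) • a ∧ ⁅sl2E, a⁆ = 0 := by
  obtain ⟨u, hu⟩ := exists_hasPrimitiveVectorWith_F j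
  rw [mult_eq_homDim]
  exact homDim_symPow_pos_iff sl2_eq_combination hu (finrank_F j)

/-- The product of two covariants is a covariant. -/
theorem mult_pos_add {m n d i j : ℕ} (hm : 0 < mult m d i) (hn : 0 < mult n d j) :
    0 < mult (m + n) d (i + j) :=
  mult_pos_iff.2 (exists_highestWeight_mul (mult_pos_iff.1 hm) (mult_pos_iff.1 hn))

end Sl2

/-! ### Counting partitions in a box -/

section Boxes

/-- One step of the recursion for `boxCount`: from largest part at most `d` to largest part at
most `d + 1`. -/
def boxStep (d : ℕ) (g : ℕ → ℕ → ℕ) : ℕ → ℕ → ℕ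
  | 0, k => if k = 0 then 1 else 0
  | m + 1, k => g (m + 1) k + if d + 1 ≤ k then boxStep d g m (k - (d + 1)) else 0

/-- The number of partitions of `k` into at most `m` parts of size at most `d`. -/
def boxCount : ℕ → ℕ → ℕ → ℕ
  | 0 => fun _ k => if k = 0 then 1 else 0
  | d + 1 => boxStep d (boxCount d)

theorem boxCount_zero_left (m k : ℕ) : boxCount 0 m k = if k = 0 then 1 else 0 := rfl

theorem boxCount_zero_right (d k : ℕ) : boxCount d 0 k = if k = 0 then 1 else 0 := by
  cases d <;> rfl

theorem boxCount_succ_succ (d m k : ℕ) : boxCount (d + 1) (m + 1) k =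
    boxCount d (m + 1) k + if d + 1 ≤ k then boxCount (d + 1) m (k - (d + 1)) else 0 := rfl

theorem boxSet_finite (m d k : ℕ) : (boxSet m d k).Finite := by
  refine (Set.finite_Iic (fun _ : Fin (d + 1) => m)).subset fun s hs i => ?_
  rw [← hs.1]
  exact Finset.single_le_sum (f := s) (fun _ _ => Nat.zero_le _) (Finset.mem_univ i)

/-- Split according to whether the variable of largest weight `d + 1` occurs; if it does, remove one
copy of it. -/
theorem boxSet_succ_succ (m d k : ℕ) : boxSet (m + 1) (d + 1) k =
    (fun s : Fin (d + 1) → ℕ => (Fin.snoc s 0 : Fin (d + 2) → ℕ)) '' boxSet (m + 1) d k ∪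
    (fun s : Fin (d + 2) → ℕ => s + Pi.single (Fin.last (d + 1)) 1) ''
      {s | ∑ i, s i = m ∧ ∑ i, s i * (i : ℕ) + (d + 1) = k} := by
  ext s
  constructor
  · rintro ⟨h1, h2⟩
    by_cases h0 : s (Fin.last (d + 1)) = 0
    · left
      refine ⟨Fin.init s, ⟨?_, ?_⟩, ?_⟩
      · rw [Fin.sum_univ_castSucc, h0] at h1
        exact h1
      · rw [Fin.sum_univ_castSucc, h0] at h2
        simpa [Fin.init] using h2
      · change Fin.snoc (Fin.init s) 0 = s
        rw [← h0, Fin.snoc_init_self]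
    · right
      obtain ⟨c, hc⟩ := Nat.exists_eq_succ_of_ne_zero h0
      refine ⟨Fin.snoc (Fin.init s) c, ⟨?_, ?_⟩, ?_⟩
      · rw [Fin.sum_univ_castSucc] at h1 ⊢
        simp only [Fin.snoc_castSucc, Fin.snoc_last, Fin.init]
        omega
      · rw [Fin.sum_univ_castSucc] at h2 ⊢
        simp only [Fin.snoc_castSucc, Fin.snoc_last, Fin.init, Fin.val_castSucc,
          Fin.val_last] at h2 ⊢
        rw [hc, Nat.succ_mul] at h2
        omega
      · funext i
        refine Fin.lastCases ?_ (fun i => ?_) i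
        · simp [hc]
        · simp [Fin.init, Fin.ext_iff, i.2.ne]
  · rintro (⟨t, ⟨h1, h2⟩, rfl⟩ | ⟨t, ⟨h1, h2⟩, rfl⟩)
    · refine ⟨?_, ?_⟩
      · simp [Fin.sum_univ_castSucc, h1]
      · simp [Fin.sum_univ_castSucc, h2]
    · refine ⟨?_, ?_⟩
      · simp [Finset.sum_add_distrib, h1]
      · simp only [Pi.add_apply, add_mul, Finset.sum_add_distrib, Pi.single_apply, ite_mul, one_mul,
          zero_mul, Finset.sum_ite_eq', Finset.mem_univ, if_true, Fin.val_last, h2]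

theorem card_boxSet_zero_right (m k : ℕ) :
    Nat.card (boxSet m 0 k) = if k = 0 then 1 else 0 := by
  split_ifs with h
  · have : boxSet m 0 k = {fun _ => m} := by
      ext s
      constructor
      · rintro ⟨h1, -⟩
        funext i
        rw [Fin.sum_univ_succ] at h1
        rw [Fin.fin_one_eq_zero i]
        simpa using h1
      · rintro rfl
        exact ⟨by simp, by simp [h]⟩
    simp [this]
  · have : boxSet m 0 k = ∅ := by
      rw [Set.eq_empty_iff_forall_notMem]
      rintro s ⟨-, hs⟩
      simp at hs
      omega
    simp [this]

theorem card_boxSet_zero_left (d k : ℕ) :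
    Nat.card (boxSet 0 d k) = if k = 0 then 1 else 0 := by
  have h0 (s : Fin (d + 1) → ℕ) (hs : ∑ i, s i = 0) : s = 0 := by
    funext i
    exact Finset.sum_eq_zero_iff.1 hs i (Finset.mem_univ i)
  split_ifs with h
  · have : boxSet 0 d k = {0} := by
      ext s
      constructor
      · rintro ⟨hs, -⟩
        exact h0 s hs
      · rintro rfl
        exact ⟨by simp, by simp [h]⟩
    simp [this]
  · have : boxSet 0 d k = ∅ := by
      rw [Set.eq_empty_iff_forall_notMem]
      rintro s ⟨hs, hk⟩
      rw [h0 s hs] at hk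
      simp at hk
      omega
    simp [this]

theorem card_boxSet (m d k : ℕ) : Nat.card (boxSet m d k) = boxCount d m k := by
  induction d generalizing m k with
  | zero => rw [card_boxSet_zero_right, boxCount_zero_left]
  | succ d ihd =>
    induction m generalizing k with
    | zero => rw [card_boxSet_zero_left, boxCount_zero_right]
    | succ m ihm =>
      have hset : {s : Fin (d + 2) → ℕ | ∑ i, s i = m ∧ ∑ i, s i * (i : ℕ) + (d + 1) = k} =
          if d + 1 ≤ k then boxSet m (d + 1) (k - (d + 1)) else ∅ := by
        split_ifs with h
        · ext s
          refine and_congr_right fun _ => ?_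
          change _ ↔ ∑ i : Fin (d + 2), s i * (i : ℕ) = k - (d + 1)
          omega
        · rw [Set.eq_empty_iff_forall_notMem]
          rintro s ⟨-, hs⟩
          omega
      have hfin : {s : Fin (d + 2) → ℕ |
          ∑ i, s i = m ∧ ∑ i, s i * (i : ℕ) + (d + 1) = k}.Finite := by
        rw [hset]
        split_ifs
        · exact boxSet_finite _ _ _
        · exact Set.finite_empty
      rw [boxCount_succ_succ, Nat.card_coe_set_eq, boxSet_succ_succ,
        Set.ncard_union_eq _ ((boxSet_finite _ _ _).image _) (hfin.image _),
        Set.ncard_image_of_injective, Set.ncard_image_of_injective, ← Nat.card_coe_set_eq, ihd,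
        hset]
      · congr 1
        split_ifs
        · rw [← ihm, Nat.card_coe_set_eq]
        · exact Set.ncard_empty _
      · exact add_left_injective _
      · intro s t hst
        have := congrArg Fin.init hst
        simpa using this
      · rw [Set.disjoint_left]
        rintro _ ⟨s, -, rfl⟩ ⟨t, -, ht⟩
        have := congrFun ht (Fin.last (d + 1))
        simp at this

theorem boxCount_one_left (m k : ℕ) : boxCount 1 m k = if k ≤ m then 1 else 0 := by
  induction m generalizing k with
  | zero => simp [boxCount_zero_right]
  | succ m ih =>
    rw [boxCount_succ_succ, boxCount_zero_left, ih]
    split_ifs <;> omega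

theorem boxCount_one_right (d k : ℕ) : boxCount d 1 k = if k ≤ d then 1 else 0 := by
  induction d generalizing k with
  | zero => simp [boxCount_zero_left]
  | succ d ih =>
    rw [boxCount_succ_succ, boxCount_zero_right, ih]
    split_ifs <;> omega

/-- The recursion conjugate to `boxCount_succ_succ`: either there are at most `m` parts, or `1` is
subtracted from each of the `m + 1` parts. Having both recursions makes the symmetry in `d` and `m`
an immediate induction. -/
theorem boxCount_succ_succ' (d m k : ℕ) : boxCount (d + 1) (m + 1) k =
    boxCount (d + 1) m k + if m + 1 ≤ k then boxCount d (m + 1) (k - (m + 1)) else 0 := by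
  induction d generalizing m k with
  | zero =>
    simp only [boxCount_zero_left, zero_add, boxCount_one_left]
    split_ifs <;> omega
  | succ d ihd =>
    induction m generalizing k with
    | zero =>
      simp only [boxCount_zero_right, zero_add, boxCount_one_right]
      split_ifs <;> omega
    | succ m ihm =>
      rw [boxCount_succ_succ (d + 1) (m + 1), ihd (m + 1), ihm, boxCount_succ_succ (d + 1) m,
        boxCount_succ_succ d (m + 1)]
      have h : k - (d + 1 + 1) - (m + 1) = k - (m + 1 + 1) - (d + 1) := by omega
      rw [h]
      split_ifs <;> omega

theorem boxCount_comm (d m k : ℕ) : boxCount d m k = boxCount m d k := by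
  induction d generalizing m k with
  | zero => rw [boxCount_zero_left, boxCount_zero_right]
  | succ d ihd =>
    induction m generalizing k with
    | zero => rw [boxCount_zero_left, boxCount_zero_right]
    | succ m ihm =>
      rw [boxCount_succ_succ', boxCount_succ_succ, ihm, ihd]

end Boxes

/-! ### Hermite reciprocity and existence of the minimum -/

section Reciprocity

theorem mult_add_boxCount {m d j k : ℕ} (hk : m * d = j + 2 * k) :
    mult m d j + (if k = 0 then 0 else boxCount d m (k - 1)) = boxCount d m k := by
  rw [← card_boxSet, ← card_boxSet]
  exact mult_add_card hk

/-- Hermite reciprocity. -/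
theorem mult_comm (m d j : ℕ) : mult m d j = mult d m j := by
  by_cases h : ∃ k, m * d = j + 2 * k
  · obtain ⟨k, hk⟩ := h
    have h1 := mult_add_boxCount hk
    have h2 := mult_add_boxCount ((mul_comm d m).trans hk)
    rw [boxCount_comm, boxCount_comm d m k] at h1
    omega
  · push Not at h
    rw [mult_eq_zero h, mult_eq_zero fun k hk => h k ((mul_comm m d).trans hk)]

theorem ell_comm (m d : ℕ) : ell m d = ell d m := by
  simp only [ell, mult_comm m d]

/-- The top weight comes from a single monomial, the `m`-th power of the highest weight variable.
This makes the set defining `ell` nonempty. -/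
theorem mult_mul_pos (m d : ℕ) : 0 < mult m d (m * d) := by
  have h := mult_add_boxCount (m := m) (d := d) (j := m * d) (k := 0) rfl
  have h1 : boxCount d m 0 = 1 := by
    rw [← card_boxSet]
    have : boxSet m d 0 = {Pi.single 0 m} := by
      ext s
      constructor
      · rintro ⟨h1, h2⟩
        have h3 (i : Fin d) : s i.succ = 0 := by
          have := Finset.sum_eq_zero_iff.1 h2 i.succ (Finset.mem_univ _)
          simpa using this
        rw [Fin.sum_univ_succ] at h1
        simp only [h3, Finset.sum_const_zero, add_zero] at h1
        funext i
        refine Fin.cases ?_ (fun i => ?_) i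
        · simp [h1]
        · simp [h3]
      · rintro rfl
        refine ⟨by simp, ?_⟩
        simp [Pi.single_apply]
    simp [this]
  rw [h1] at h
  simp at h
  omega

theorem isLeast_ell (m d : ℕ) : IsLeast {j : ℕ | 0 < mult m d j} (ell m d) :=
  ⟨Nat.sInf_mem ⟨_, mult_mul_pos m d⟩, fun _ hj => Nat.sInf_le hj⟩

end Reciprocity

/-! ### Closed forms for boxes of width two and three -/

section SmallBoxes

/-- The number `b` of parts equal to `2` runs from `max (k - m) 0` to `k / 2`; truncated subtraction
supplies the maximum. -/
theorem boxCount_two (m k : ℕ) :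
    boxCount 2 m k = if k ≤ 2 * m then k / 2 + 1 - (k - m) else 0 := by
  induction m generalizing k with
  | zero =>
    rw [boxCount_zero_right]
    split_ifs <;> omega
  | succ m ih =>
    rw [boxCount_succ_succ, boxCount_one_left, ih]
    split_ifs <;> omega

/-- An evaluation of `boxCount (d + 2)` that starts from the closed form for `boxCount 2`. -/
def fastBoxCount : ℕ → ℕ → ℕ → ℕ
  | 0 => fun m k => if k ≤ 2 * m then k / 2 + 1 - (k - m) else 0
  | d + 1 => boxStep (d + 2) (fastBoxCount d)

theorem fastBoxCount_eq (d : ℕ) : fastBoxCount d = boxCount (d + 2) := by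
  induction d with
  | zero =>
    funext m k
    rw [boxCount_two, fastBoxCount]
  | succ d ih =>
    rw [fastBoxCount, ih]
    rfl

/-- The number of solutions of `2 * a + 3 * b = n` in natural numbers. -/
def twoThreeCount (n : ℤ) : ℤ :=
  if n < 0 then 0 else if n % 6 = 1 then n / 6 else n / 6 + 1

theorem twoThreeCount_eq (n : ℤ) :
    twoThreeCount n = twoThreeCount (n - 3) + if 0 ≤ n ∧ n % 2 = 0 then 1 else 0 := by
  unfold twoThreeCount
  split_ifs <;> omega

/-- The generating function of the left side is `(1 - q^(m+1))(1 - q^(m+2))(1 - q^(m+3)) / ((1 -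
q^2)(1 - q^3))`. The products of two or more powers in the numerator start at `q^(2m+3)`, whence the
bound on `k`. -/
theorem boxCount_three_sub (m k : ℕ) (hk : k ≤ 2 * m + 2) :
    (boxCount 3 m k : ℤ) - (if k = 0 then 0 else boxCount 3 m (k - 1) : ℕ) =
      twoThreeCount k - twoThreeCount (k - m - 1) - twoThreeCount (k - m - 2) -
        twoThreeCount (k - m - 3) := by
  induction m generalizing k with
  | zero =>
    simp only [boxCount_zero_right, twoThreeCount]
    split_ifs <;> omega
  | succ m ih =>
    -- The same expansion for width two, `(1 - q^(m+2))(1 - q^(m+3)) / (1 - q^2)`, truncated below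
    -- `q^(2m+5)`.
    have h2 : (boxCount 2 (m + 1) k : ℤ) - (if k = 0 then 0 else boxCount 2 (m + 1) (k - 1) : ℕ) =
        (if 0 ≤ (k : ℤ) ∧ (k : ℤ) % 2 = 0 then 1 else 0) -
        (if 0 ≤ (k : ℤ) - m - 2 ∧ ((k : ℤ) - m - 2) % 2 = 0 then 1 else 0) -
        (if 0 ≤ (k : ℤ) - m - 3 ∧ ((k : ℤ) - m - 3) % 2 = 0 then 1 else 0) := by
      simp only [boxCount_two]
      split_ifs <;> omega
    have e0 := twoThreeCount_eq k
    have e1 := twoThreeCount_eq (k - m - 2)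
    have e2 := twoThreeCount_eq (k - m - 3)
    have s0 : (k : ℤ) - ((m + 1 : ℕ) : ℤ) - 1 = k - m - 2 := by push_cast; ring
    have s1 : (k : ℤ) - ((m + 1 : ℕ) : ℤ) - 2 = k - m - 3 := by push_cast; ring
    have s2 : (k : ℤ) - ((m + 1 : ℕ) : ℤ) - 3 = k - m - 4 := by push_cast; ring
    have s3 : (k : ℤ) - m - 2 - 3 = k - m - 5 := by ring
    have s4 : (k : ℤ) - m - 3 - 3 = k - m - 6 := by ring
    rw [s3] at e1
    rw [s4] at e2
    rw [s0, s1, s2]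
    have h3 : (boxCount 3 (m + 1) k : ℤ) -
        (if k = 0 then 0 else boxCount 3 (m + 1) (k - 1) : ℕ) =
        (boxCount 2 (m + 1) k : ℤ) - (if k = 0 then 0 else boxCount 2 (m + 1) (k - 1) : ℕ) +
        (twoThreeCount (k - 3) - twoThreeCount (k - m - 4) - twoThreeCount (k - m - 5) -
          twoThreeCount (k - m - 6)) := by
      by_cases h : 3 ≤ k
      · have ih' := ih (k - 3) (by omega)
        have c0 : ((k - 3 : ℕ) : ℤ) = k - 3 := by omega
        have c1 : (k : ℤ) - 3 - m - 1 = k - m - 4 := by ring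
        have c2 : (k : ℤ) - 3 - m - 2 = k - m - 5 := by ring
        have c3 : (k : ℤ) - 3 - m - 3 = k - m - 6 := by ring
        rw [c0, c1, c2, c3] at ih'
        rw [← ih', boxCount_succ_succ, boxCount_succ_succ 2 m (k - 1), if_pos h,
          if_neg (by omega : ¬ k = 0), if_neg (by omega : ¬ k = 0)]
        have c4 : k - 1 - (2 + 1) = k - 3 - 1 := by omega
        rw [c4]
        split_ifs <;> push_cast <;> omega
      · have z (n : ℤ) (hn : n < 0) : twoThreeCount n = 0 := by
          rw [twoThreeCount, if_pos hn]
        rw [z (k - 3) (by omega), z (k - m - 4) (by omega), z (k - m - 5) (by omega),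
          z (k - m - 6) (by omega), boxCount_succ_succ, boxCount_succ_succ 2 m (k - 1),
          if_neg h, if_neg (by omega : ¬ 2 + 1 ≤ k - 1)]
        simp
    rw [h3, h2, e0, e1, e2]
    ring

end SmallBoxes

/-! ### Construction of covariants and the values of `ell` -/

section Multiplicities

/-- Reduces a concrete multiplicity to a kernel computation. The explicit argument is the smaller
index, `(m (d + 2) - j) / 2 - 1`. -/
theorem mult_pos_of_fastBoxCount {m d j : ℕ} (k : ℕ) (hk : m * (d + 2) = j + 2 * (k + 1))
    (h : fastBoxCount d m k < fastBoxCount d m (k + 1)) : 0 < mult m (d + 2) j := by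
  have := mult_add_boxCount hk
  rw [fastBoxCount_eq] at h
  rw [if_neg (Nat.succ_ne_zero k), Nat.add_sub_cancel] at this
  omega

theorem mult_eq_zero_of_fastBoxCount {m d j : ℕ} (k : ℕ) (hk : m * (d + 2) = j + 2 * (k + 1))
    (h : fastBoxCount d m k = fastBoxCount d m (k + 1)) : mult m (d + 2) j = 0 := by
  have := mult_add_boxCount hk
  rw [fastBoxCount_eq] at h
  rw [if_neg (Nat.succ_ne_zero k), Nat.add_sub_cancel] at this
  omega

theorem mult_eq_zero_of_odd {m d j : ℕ} (h : Odd (m * d + j)) : mult m d j = 0 := by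
  refine mult_eq_zero fun k hk => ?_
  rw [hk, Nat.odd_iff] at h
  omega

theorem mult_pos_comm {m d j : ℕ} (h : 0 < mult m d j) : 0 < mult d m j :=
  mult_comm m d j ▸ h

theorem mult_zero_left_pos (d : ℕ) : 0 < mult 0 d 0 := by
  simpa using mult_mul_pos 0 d

/-- Multiplying a covariant by a power of an invariant. -/
theorem mult_pos_add_mul {m n d j : ℕ} (hm : 0 < mult m d j) (hn : 0 < mult n d 0) (a : ℕ) :
    0 < mult (m + a * n) d j := by
  induction a with
  | zero => simpa using hm
  | succ a ih =>
    have := mult_pos_add ih hn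
    rwa [add_zero, add_assoc, ← Nat.succ_mul] at this

theorem mult_pos_add_mul_right {m n d j : ℕ} (hm : 0 < mult d m j) (hn : 0 < mult d n 0)
    (a : ℕ) : 0 < mult d (m + a * n) j :=
  mult_pos_comm (mult_pos_add_mul (mult_pos_comm hm) (mult_pos_comm hn) a)

theorem mult_mul_pos_zero {n d : ℕ} (hn : 0 < mult n d 0) (a : ℕ) : 0 < mult (a * n) d 0 := by
  simpa using mult_pos_add_mul (mult_zero_left_pos d) hn a

theorem ell_eq {m d j : ℕ} (hj : 0 < mult m d j) (h : ∀ i < j, mult m d i = 0) :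
    ell m d = j := by
  refine le_antisymm ((isLeast_ell m d).2 hj) ?_
  by_contra! hlt
  exact (isLeast_ell m d).1.ne' (h _ hlt)

/-- Powers of the discriminant of the binary quadratic, then reciprocity, then powers again. -/
theorem mult_even_even_pos {m d : ℕ} (hm : m % 2 = 0) (hd : d % 2 = 0) : 0 < mult m d 0 := by
  have h22 : 0 < mult 2 2 0 := mult_pos_of_fastBoxCount 1 rfl (by decide +kernel)
  have h := mult_mul_pos_zero (mult_pos_comm (mult_mul_pos_zero h22 (m / 2))) (d / 2)
  rw [Nat.div_mul_cancel (Nat.dvd_of_mod_eq_zero hm),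
    Nat.div_mul_cancel (Nat.dvd_of_mod_eq_zero hd)] at h
  exact mult_pos_comm h

/-- Odd `d` starts from the discriminant of the binary cubic, of degree `4`, and increases `d` in
steps of `2` through the invariant at (4,2). -/
theorem mult_four_left_pos {d : ℕ} (hd : d ≠ 1) : 0 < mult 4 d 0 := by
  have h43 : 0 < mult 4 3 0 := mult_pos_of_fastBoxCount 5 rfl (by decide +kernel)
  rcases Nat.even_or_odd' d with ⟨c, rfl | rfl⟩
  · exact mult_even_even_pos rfl (by omega)
  · have := mult_pos_add_mul_right h43 (mult_even_even_pos (m := 4) (d := 2) rfl rfl) (c - 1)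
    rwa [show 3 + (c - 1) * 2 = 2 * c + 1 by omega] at this

theorem mult_mod_four_eq_zero_pos {m d : ℕ} (hm : m ≠ 1) (hd : d % 4 = 0) : 0 < mult m d 0 := by
  have h := mult_mul_pos_zero (mult_four_left_pos hm) (d / 4)
  rw [Nat.div_mul_cancel (Nat.dvd_of_mod_eq_zero hd)] at h
  exact mult_pos_comm h

theorem ell_one_right (m : ℕ) : ell m 1 = m := by
  refine ell_eq (by simpa using mult_mul_pos m 1) fun j hj => ?_
  by_cases h : ∃ k, m * 1 = j + 2 * k
  · obtain ⟨k, hk⟩ := h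
    have := mult_add_boxCount hk
    rw [boxCount_one_left, boxCount_one_left, if_neg (by omega), if_pos (by omega),
      if_pos (by omega)] at this
    omega
  · push Not at h
    exact mult_eq_zero h

theorem ell_two_right_of_odd {m : ℕ} (hm : m % 2 = 1) : ell m 2 = 2 := by
  have hpos := mult_pos_add_mul (mult_mul_pos 1 2)
    (mult_even_even_pos (m := 2) (d := 2) rfl rfl) (m / 2)
  rw [show 1 + m / 2 * 2 = m by omega] at hpos
  refine ell_eq hpos fun j hj => ?_
  interval_cases j
  -- For odd `m` the counts at `m - 1` and `m` agree, because `(m - 1) / 2 = m / 2`.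
  · have := mult_add_boxCount (m := m) (d := 2) (j := 0) (k := m) (by omega)
    rw [boxCount_two, boxCount_two] at this
    split_ifs at this <;> omega
  · exact mult_eq_zero_of_odd (by rw [Nat.odd_iff]; omega)

theorem mult_three_right_zero {m : ℕ} (hm : m % 4 = 2) : mult m 3 0 = 0 := by
  have h := boxCount_three_sub m (3 * (m / 2)) (by omega)
  rw [← mult_add_boxCount (m := m) (d := 3) (j := 0) (k := 3 * (m / 2)) (by omega)] at h
  simp only [twoThreeCount] at h
  push_cast at h
  split_ifs at h <;> omega

theorem mult_three_right_one (m : ℕ) : mult m 3 1 = 0 := by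
  rcases Nat.even_or_odd' m with ⟨c, rfl | rfl⟩
  · exact mult_eq_zero_of_odd (by rw [Nat.odd_iff]; omega)
  · have h := boxCount_three_sub (2 * c + 1) (3 * c + 1) (by omega)
    rw [← mult_add_boxCount (m := 2 * c + 1) (d := 3) (j := 1) (k := 3 * c + 1) (by omega)] at h
    simp only [twoThreeCount] at h
    push_cast at h
    split_ifs at h <;> omega

/-- Multiplication by powers of the cubic discriminant, of degree `4`. -/
theorem mult_three_right_pos {m j : ℕ} (h : 0 < mult (m % 4) 3 j) : 0 < mult m 3 j := by
  have := mult_pos_add_mul h (mult_four_left_pos (d := 3) (by omega)) (m / 4)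
  rwa [show m % 4 + m / 4 * 4 = m by omega] at this

theorem ell_three_right_of_mod_eq_two {m : ℕ} (hm : m % 4 = 2) : ell m 3 = 2 := by
  refine ell_eq (mult_three_right_pos ?_) fun j hj => ?_
  · rw [hm]
    exact mult_pos_of_fastBoxCount 1 rfl (by decide +kernel)
  · interval_cases j
    · exact mult_three_right_zero hm
    · exact mult_three_right_one m

theorem ell_three_right_of_odd {m : ℕ} (hm : m % 4 = 1 ∨ m % 4 = 3) : ell m 3 = 3 := by
  refine ell_eq (mult_three_right_pos ?_) fun j hj => ?_
  · rcases hm with hm | hm <;> rw [hm]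
    · exact mult_mul_pos 1 3
    · exact mult_pos_of_fastBoxCount 2 rfl (by decide +kernel)
  · interval_cases j
    · exact mult_eq_zero_of_odd (by rw [Nat.odd_iff]; omega)
    · exact mult_three_right_one m
    · exact mult_eq_zero_of_odd (by rw [Nat.odd_iff]; omega)

/-- A linear covariant exists when the degrees are odd and at least `5`. -/
theorem mult_odd_odd_pos {m d : ℕ} (hm : m % 2 = 1) (hd : d % 2 = 1) (hm5 : 5 ≤ m)
    (hd5 : 5 ≤ d) : 0 < mult m d 1 := by
  have h55 : 0 < mult 5 5 1 := mult_pos_of_fastBoxCount 11 rfl (by decide +kernel)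
  have h57 : 0 < mult 5 7 1 := mult_pos_of_fastBoxCount 16 rfl (by decide +kernel)
  have h77 : 0 < mult 7 7 1 := mult_pos_of_fastBoxCount 23 rfl (by decide +kernel)
  -- Invariants of degree `4` move each argument by `4`, so one seed per pair of odd residues mod
  -- `4` is enough; reciprocity provides (7,5).
  have step {n e : ℕ} (h : 0 < mult n e 1) (hn : n ≤ m) (he : e ≤ d) (he2 : 2 ≤ e)
      (hnm : n % 4 = m % 4) (hed : e % 4 = d % 4) : 0 < mult m d 1 := by
    have h1 := mult_pos_add_mul h (mult_four_left_pos (d := e) (by omega)) ((m - n) / 4)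
    rw [show n + (m - n) / 4 * 4 = m by omega] at h1
    have h2 := mult_pos_add_mul_right h1
      (mult_pos_comm (mult_four_left_pos (d := m) (by omega))) ((d - e) / 4)
    rwa [show e + (d - e) / 4 * 4 = d by omega] at h2
  by_cases h1 : m % 4 = 1
  · by_cases h2 : d % 4 = 1
    · exact step h55 (by omega) (by omega) (by omega) (by omega) (by omega)
    · exact step h57 (by omega) (by omega) (by omega) (by omega) (by omega)
  · by_cases h2 : d % 4 = 1
    · exact step (mult_pos_comm h57) (by omega) (by omega) (by omega) (by omega) (by omega)
    · exact step h77 (by omega) (by omega) (by omega) (by omega) (by omega)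

/-- Invariants of binary forms of degree `d ≡ 2 (mod 4)` that have odd degree `m`. -/
theorem mult_odd_mod_four_eq_two_pos {m d : ℕ} (hm : m % 2 = 1) (hd : d % 4 = 2)
    (h : (5 ≤ m ∧ 18 ≤ d) ∨ (7 ≤ m ∧ 14 ≤ d) ∨ (9 ≤ m ∧ 10 ≤ d) ∨ (15 ≤ m ∧ 6 ≤ d)) :
    0 < mult m d 0 := by
  have h5 : 0 < mult 5 18 0 := mult_pos_of_fastBoxCount 44 rfl (by decide +kernel)
  have h7 : 0 < mult 7 14 0 := mult_pos_of_fastBoxCount 48 rfl (by decide +kernel)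
  have h9 : 0 < mult 9 10 0 := mult_pos_of_fastBoxCount 44 rfl (by decide +kernel)
  have h15 : 0 < mult 15 6 0 := mult_pos_of_fastBoxCount 44 rfl (by decide +kernel)
  -- The degree `m` grows by `2`, as `e` is even and (2,e) has an invariant; `d` then grows by `4`,
  -- through the invariant at (4,m).
  have step {n e : ℕ} (h : 0 < mult n e 0) (hnm : n % 2 = 1) (hed : e % 4 = 2) (hn : n ≤ m)
      (he : e ≤ d) (hm1 : m ≠ 1) : 0 < mult m d 0 := by
    have h1 := mult_pos_add_mul h (mult_even_even_pos (m := 2) (d := e) rfl (by omega))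
      ((m - n) / 2)
    rw [show n + (m - n) / 2 * 2 = m by omega] at h1
    have h2 := mult_pos_add_mul_right h1
      (mult_pos_comm (mult_four_left_pos (d := m) hm1)) ((d - e) / 4)
    rwa [show e + (d - e) / 4 * 4 = d by omega] at h2
  rcases h with ⟨h, h'⟩ | ⟨h, h'⟩ | ⟨h, h'⟩ | ⟨h, h'⟩
  · exact step h5 rfl rfl h h' (by omega)
  · exact step h7 rfl rfl h h' (by omega)
  · exact step h9 rfl rfl h h' (by omega)
  · exact step h15 rfl rfl h h' (by omega)

theorem ell_eq_two_of_mem_E {m d : ℕ} (h : (m, d) ∈ E) : ell m d = 2 := by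
  -- Weight `0` sits at index `k + 2` and weight `2` at `k + 1`: the count stays equal in the last
  -- step and rises in the one before.
  have two {n e : ℕ} (k : ℕ) (hk : n * (e + 2) = 2 * (k + 2))
      (h0 : fastBoxCount e n (k + 1) = fastBoxCount e n (k + 2))
      (h2 : fastBoxCount e n k < fastBoxCount e n (k + 1)) : ell n (e + 2) = 2 := by
    refine ell_eq (mult_pos_of_fastBoxCount k (by omega) h2) fun j hj => ?_
    interval_cases j
    · exact mult_eq_zero_of_fastBoxCount (k + 1) (by omega) h0
    · exact mult_eq_zero_of_odd (by rw [Nat.odd_iff]; omega)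
  simp only [E, Set.mem_insert_iff, Set.mem_singleton_iff, Prod.mk.injEq] at h
  rcases h with ⟨rfl, rfl⟩ | ⟨rfl, rfl⟩ | ⟨rfl, rfl⟩ | ⟨rfl, rfl⟩ | ⟨rfl, rfl⟩ | ⟨rfl, rfl⟩ |
    ⟨rfl, rfl⟩ | ⟨rfl, rfl⟩
  · exact two 13 rfl (by decide +kernel) (by decide +kernel)
  · exact two 23 rfl (by decide +kernel) (by decide +kernel)
  · exact two 33 rfl (by decide +kernel) (by decide +kernel)
  · exact two 19 rfl (by decide +kernel) (by decide +kernel)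
  · exact two 25 rfl (by decide +kernel) (by decide +kernel)
  · exact two 31 rfl (by decide +kernel) (by decide +kernel)
  · exact two 37 rfl (by decide +kernel) (by decide +kernel)
  · exact two 33 rfl (by decide +kernel) (by decide +kernel)

theorem mult_pos_of_notMem_E {m d : ℕ} (hm : 5 ≤ m) (hmd : m ≤ d) (hE : (m, d) ∉ E)
    (hodd : ¬(Odd m ∧ Odd d)) : 0 < mult m d 0 := by
  rw [Nat.odd_iff, Nat.odd_iff] at hodd
  by_cases hm4 : m % 4 = 0
  · exact mult_pos_comm (mult_mod_four_eq_zero_pos (by omega) hm4)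
  by_cases hd4 : d % 4 = 0
  · exact mult_mod_four_eq_zero_pos (by omega) hd4
  by_cases hm2 : m % 2 = 0
  · by_cases hd2 : d % 2 = 0
    · exact mult_even_even_pos hm2 hd2
    · refine mult_pos_comm (mult_odd_mod_four_eq_two_pos (by omega) (by omega) ?_)
      by_contra hc
      -- One degree is now odd and the other is `2` mod `4`. The pairs below all four thresholds,
      -- here and in the opposite parity case, are exactly those of `E`.
      have : m = 6 ∧ (d = 7 ∨ d = 9 ∨ d = 11 ∨ d = 13) := by omega
      obtain ⟨rfl, rfl | rfl | rfl | rfl⟩ := this <;> simp [E] at hE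
  · refine mult_odd_mod_four_eq_two_pos (by omega) (by omega) ?_
    by_contra hc
    have : m = 5 ∧ (d = 6 ∨ d = 10 ∨ d = 14) ∨ m = 7 ∧ d = 10 := by omega
    obtain ⟨rfl, rfl | rfl | rfl⟩ | ⟨rfl, rfl⟩ := this <;> simp [E] at hE

end Multiplicities

end BinaryForms

end

open BinaryForms in
theorem mainTheorem3 :
    -- the minimum that defines `ℓ(m, d)` is attained
    (∀ m d : ℕ, IsLeast {j : ℕ | 0 < mult m d j} (ell m d)) ∧
    (∀ m d : ℕ, ell m d = ell d m) ∧
    (∀ m : ℕ, ell m 0 = 0) ∧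
    (∀ m : ℕ, ell m 1 = m) ∧
    (∀ m : ℕ, (Even m → ell m 2 = 0) ∧ (Odd m → ell m 2 = 2)) ∧
    (∀ m : ℕ, (m % 4 = 0 → ell m 3 = 0) ∧ (m % 4 = 2 → ell m 3 = 2) ∧
      (m % 4 = 1 ∨ m % 4 = 3 → ell m 3 = 3)) ∧
    (∀ m : ℕ, m ≠ 1 → ell 4 m = 0) ∧
    ell 4 1 = 4 ∧
    (∀ m d : ℕ, 5 ≤ m → m ≤ d →
      ((m, d) ∈ E → ell m d = 2) ∧
      ((m, d) ∉ E → Odd m → Odd d → ell m d = 1) ∧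
      ((m, d) ∉ E → ¬ (Odd m ∧ Odd d) → ell m d = 0)) := by
  have zero {m d : ℕ} (h : 0 < mult m d 0) : ell m d = 0 := ell_eq h (by simp)
  refine ⟨isLeast_ell, ell_comm, fun m => zero (mult_mul_pos m 0), ell_one_right,
    fun m => ⟨fun hm => zero (mult_even_even_pos (Nat.even_iff.1 hm) rfl),
      fun hm => ell_two_right_of_odd (Nat.odd_iff.1 hm)⟩,
    fun m => ⟨fun hm => zero (mult_pos_comm (mult_mod_four_eq_zero_pos (by omega) hm)),
      ell_three_right_of_mod_eq_two, ell_three_right_of_odd⟩,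
    fun m hm => zero (mult_four_left_pos hm), ell_one_right 4,
    fun m d hm hmd => ⟨ell_eq_two_of_mem_E, fun _ h1 h2 => ?_,
      fun hE hodd => zero (mult_pos_of_notMem_E hm hmd hE hodd)⟩⟩
  refine ell_eq (mult_odd_odd_pos (Nat.odd_iff.1 h1) (Nat.odd_iff.1 h2) hm (hm.trans hmd))
    fun j hj => ?_
  obtain rfl : j = 0 := by omega
  exact mult_eq_zero_of_odd (by simpa using h1.mul h2)
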